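/- Let $p\ge 3$ and $n\ge 1$ be integers, and let $\boldsymbol X\sim \mathrm N_p(\boldsymbol\theta,\sigma^2\boldsymbol I_p)$ and $S\sim\sigma^2\chi^2_n$ be independent, with $\boldsymbol\theta\in\mathbb R^p$ and $\sigma>0$ unknown. Put $W=\|\boldsymbol X\|^2/S$. Let $\phi$ be a real function that is continuous on $(0,\infty)$ and differentiable there outside a countable set, write $$h(t)=(p-2)\frac{\phi(t)}{t}+2\phi'(t),$$ and suppose that $t^{-n/2-1}h(t)$ is integrable on $(w,\infty)$ for every $w>0$. Let $$\boldsymbol\delta_\phi=\Bigl(1-\frac{\phi(W)}{W}\Bigr)\boldsymbol X,\qquad R(\boldsymbol\delta_\phi)=\mathrm E\|\boldsymbol\delta_\phi-\boldsymbol\theta\|^2,\qquad R^*(\boldsymbol\delta_\phi)=p\sigma^2-R(\boldsymbol\delta_\phi),$$ and suppose that $R(\boldsymbol\delta_\phi)\le \mathrm E\|\boldsymbol X-\boldsymbol\theta\|^2=p\sigma^2$ for all $(\boldsymbol\theta,\sigma)$. For $w>0$ let $$g(w)=w^{n/2}\int_w^\infty t^{-n/2}\,\frac{h(t)}{t}\,dt,\qquad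 a(w)=\frac np\Bigl(g(w)-\frac{\phi(w)^2}{w}\Bigr),\qquad \ell(w)=\frac1{a(w)}\Bigl(1-\frac{n(1+w)}{n+p+2}\Bigr),$$ and, for a function $\psi$, let $\hat R(\psi;\boldsymbol\delta_\phi)=\frac{pS}{n}\bigl(1-a(W)\psi(W)\bigr)$, an estimator of $R(\boldsymbol\delta_\phi)$ with risk $\mathrm E\bigl[(\hat R(\psi;\boldsymbol\delta_\phi)-R(\boldsymbol\delta_\phi))^2\bigr]$. Let $\alpha$ be the value of $R^*(\boldsymbol\delta_\phi)/\sigma^2$ at $\boldsymbol\theta=0$, $\sigma=1$, and define $$\psi_1(w)=\min\Bigl(1,\ \frac np\cdot\frac{1+w_0}{n+p+2}\cdot\frac{\alpha}{a(w)}\Bigr),\qquad \psi_2(w)=\min\Bigl(1,\ \frac{\alpha}{p\,a(w)}\Bigr),$$ where $w_0>0$ is a solution of $\dfrac{1+w}{a(w)}=\dfrac{p(n+p+2)}{n}\cdot\dfrac1\alpha$ (the statements about $\psi_1$ hold for every such solution, and the statements about $\psi_2$ do not require one to exist). For $j=1,2$ let $$\psi_j^{TR}(w)=\max\bigl(\psi_j(w),\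 \ell(w)\bigr)\ \text{ where } a(w)>0,\qquad \psi_j^{TR}(w)=\psi_j(w)\ \text{ where } a(w)\le 0 .$$ **Theorem.** Suppose that $\mathcal B=\{w>0:\ a(w)>0,\ \ell(w)\ge 1\}\neq\emptyset$. Then, for $j=1,2$, $\hat R(\psi_j^{TR};\boldsymbol\delta_\phi)$ improves on $\hat R(\psi_j;\boldsymbol\delta_\phi)$ under squared error loss, that is: 1. the risk of $\hat R(\psi_j^{TR};\boldsymbol\delta_\phi)$ is at most the risk of $\hat R(\psi_j;\boldsymbol\delta_\phi)$ for all $(\boldsymbol\theta,\sigma)$; 2. it is strictly smaller for all $(\boldsymbol\theta,\sigma)$, unless $\psi_j^{TR}=\psi_j$ on all of $(0,\infty)$; 3. in particular it is strictly smaller for all $(\boldsymbol\theta,\sigma)$ if $\ell(w)>1$ for some $w\in\mathcal B$. -/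

import Mathlib

open MeasureTheory ProbabilityTheory Set
open scoped ENNReal

namespace ShrinkageMSE

noncomputable section

/-- The sample space `ℝᵖ` with the Euclidean norm. -/
abbrev Vec (p : ℕ) : Type := EuclideanSpace ℝ (Fin p)

/-- The chi-square distribution with `n` degrees of freedom (`n ≥ 1`):
shape `n / 2`, rate `1 / 2`. -/
def chiSq (n : ℕ) : Measure ℝ := gammaMeasure ((n : ℝ) / 2) (1 / 2)

/-- The joint law of `(X, S)`: `X ∼ N_p(θ, σ² I_p)` and `S ∼ σ² χ²_n`, independent. -/
def modelLaw (p n : ℕ) (θ : Vec p) (σ : ℝ) : Measure (Vec p × ℝ) :=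
  (multivariateGaussian θ (σ ^ 2 • (1 : Matrix (Fin p) (Fin p) ℝ))).prod
    ((chiSq n).map (fun u => σ ^ 2 * u))

/-- The statistic `W = ‖X‖² / S`. -/
def W {p : ℕ} (z : Vec p × ℝ) : ℝ := ‖z.1‖ ^ 2 / z.2

/-- The shrinkage estimator `δ_φ = (1 - φ(W) / W) X`. -/
def shrink {p : ℕ} (φ : ℝ → ℝ) (z : Vec p × ℝ) : Vec p := (1 - φ (W z) / W z) • z.1

/-- The mean squared error `E ‖δ - θ‖²` of an estimator `δ` of `θ`, with values in `[0, ∞]`. -/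
def mse (p n : ℕ) (δ : Vec p × ℝ → Vec p) (θ : Vec p) (σ : ℝ) : ℝ≥0∞ :=
  ∫⁻ z, ENNReal.ofReal (‖δ z - θ‖ ^ 2) ∂(modelLaw p n θ σ)

/-- The MSE `R(δ_φ)` as a real number. -/
def R (p n : ℕ) (φ : ℝ → ℝ) (θ : Vec p) (σ : ℝ) : ℝ :=
  (mse p n (shrink φ) θ σ).toReal

/-- The risk reduction `R*(δ_φ) = p σ² - R(δ_φ)`. -/
def Rstar (p n : ℕ) (φ : ℝ → ℝ) (θ : Vec p) (σ : ℝ) : ℝ :=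
  (p : ℝ) * σ ^ 2 - R p n φ θ σ

/-- `α_{p,n}(δ_φ)`: the value of `R*(δ_φ) / σ²` at `λ = ‖θ‖² / σ² = 0`, computed at
`θ = 0`, `σ = 1`. -/
def alpha (p n : ℕ) (φ : ℝ → ℝ) : ℝ := Rstar p n φ 0 1 / 1 ^ 2

/-- `h(t) = (p - 2) φ(t) / t + 2 φ'(t)`. -/
def h (p : ℕ) (φ : ℝ → ℝ) (t : ℝ) : ℝ := ((p : ℝ) - 2) * (φ t / t) + 2 * deriv φ t

/-- The integrand `t^{-n/2} h(t) / t`. -/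
def gIntegrand (p n : ℕ) (φ : ℝ → ℝ) (t : ℝ) : ℝ := t ^ (-((n : ℝ) / 2)) * (h p φ t / t)

/-- `g(w) = w^{n/2} ∫_w^∞ t^{-n/2} h(t) / t dt`. -/
def g (p n : ℕ) (φ : ℝ → ℝ) (w : ℝ) : ℝ :=
  w ^ ((n : ℝ) / 2) * ∫ t in Ioi w, gIntegrand p n φ t

/-- `a(w) = (n / p) (g(w) - φ(w)² / w)`, so that the unbiased estimator of the MSE is
`(p S / n) (1 - a(W))`. -/
def a (p n : ℕ) (φ : ℝ → ℝ) (w : ℝ) : ℝ :=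
  (n : ℝ) / p * (g p n φ w - φ w ^ 2 / w)

/-- The estimator `R̂(ψ; δ_φ) = (p S / n) (1 - a(W) ψ(W))` of `R(δ_φ)`. -/
def Rhat (p n : ℕ) (φ ψ : ℝ → ℝ) (z : Vec p × ℝ) : ℝ :=
  (p : ℝ) * z.2 / n * (1 - a p n φ (W z) * ψ (W z))

/-- The risk of the estimator `R̂(ψ; δ_φ)` of `R(δ_φ)` under the loss
`(R̂(ψ; δ_φ) - R(δ_φ))²`, with values in `[0, ∞]`. -/
def risk (p n : ℕ) (φ ψ : ℝ → ℝ) (θ : Vec p) (σ : ℝ) : ℝ≥0∞ :=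
  ∫⁻ z, ENNReal.ofReal ((Rhat p n φ ψ z - R p n φ θ σ) ^ 2) ∂(modelLaw p n θ σ)

/-- The bound `(1 / a(w)) (1 - n (1 + w) / (n + p + 2))`. -/
def lower (p n : ℕ) (φ : ℝ → ℝ) (w : ℝ) : ℝ :=
  1 / a p n φ w * (1 - (n : ℝ) * (1 + w) / ((n : ℝ) + p + 2))

/-- The set `𝓑`; the statistic `W` is almost surely positive and `a` is a function on `(0, ∞)`. -/
def setB (p n : ℕ) (φ : ℝ → ℝ) : Set ℝ :=
  {w | 1 ≤ lower p n φ w ∧ 0 < a p n φ w ∧ 0 < w}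

/-- `w₀` solves the equation `(1 + w) / a(w) = (p (n + p + 2) / n) (1 / α_{p,n}(δ_φ))`. -/
def IsW (p n : ℕ) (φ : ℝ → ℝ) (w₀ : ℝ) : Prop :=
  0 < w₀ ∧ (1 + w₀) / a p n φ w₀ = (p : ℝ) * ((n : ℝ) + p + 2) / n * (1 / alpha p n φ)

/-- `ψ₁(w) = min (1, (n / p) (1 + w₀) / (n + p + 2) · α_{p,n}(δ_φ) / a(w))`, where `w₀` is
`W_{p,n}(δ_φ)`. -/
def psi1 (p n : ℕ) (φ : ℝ → ℝ) (w₀ : ℝ) (w : ℝ) : ℝ :=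
  min 1 ((n : ℝ) / p * ((1 + w₀) / ((n : ℝ) + p + 2)) * (alpha p n φ / a p n φ w))

/-- `ψ₂(w) = min (1, α_{p,n}(δ_φ) / (p a(w)))`. -/
def psi2 (p n : ℕ) (φ : ℝ → ℝ) (w : ℝ) : ℝ :=
  min 1 (alpha p n φ / ((p : ℝ) * a p n φ w))

open Classical in
/-- The truncation `ψ^{TR}(w) = max (ψ(w), (1 / a(w)) (1 - n (1 + w) / (n + p + 2)))`.
It is a truncation of `a ψ` from below only where `a(w) > 0`, and `ψ` is left alone where
`a(w) ≤ 0`; when `a` is positive this is the displayed maximum everywhere. -/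
def trunc (p n : ℕ) (φ ψ : ℝ → ℝ) (w : ℝ) : ℝ :=
  if 0 < a p n φ w then max (ψ w) (lower p n φ w) else ψ w

/-- The risk of `R̂(ψ'; δ_φ)` is at most that of `R̂(ψ; δ_φ)` at every parameter point. -/
def NowhereWorse (p n : ℕ) (φ ψ' ψ : ℝ → ℝ) : Prop :=
  ∀ (θ : Vec p) (σ : ℝ), 0 < σ → risk p n φ ψ' θ σ ≤ risk p n φ ψ θ σ

/-- The risk of `R̂(ψ'; δ_φ)` is smaller than that of `R̂(ψ; δ_φ)` at every parameter point. -/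
def EverywhereBetter (p n : ℕ) (φ ψ' ψ : ℝ → ℝ) : Prop :=
  ∀ (θ : Vec p) (σ : ℝ), 0 < σ → risk p n φ ψ' θ σ < risk p n φ ψ θ σ

/-- `R̂(ψ^{TR}; δ_φ)` improves on `R̂(ψ; δ_φ)`: its risk is nowhere larger, and it is smaller
everywhere unless the truncation changes nothing on `(0, ∞)`; in particular it is smaller
everywhere if the inequality that defines `𝓑` is strict at some point of `𝓑`. -/
def TruncImproves (p n : ℕ) (φ ψ : ℝ → ℝ) : Prop :=
  NowhereWorse p n φ (trunc p n φ ψ) ψ ∧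
  ((∃ w, 0 < w ∧ trunc p n φ ψ w ≠ ψ w) → EverywhereBetter p n φ (trunc p n φ ψ) ψ) ∧
  ((∃ w ∈ setB p n φ, 1 < lower p n φ w) → EverywhereBetter p n φ (trunc p n φ ψ) ψ)

end

end ShrinkageMSE

/-! The estimator is `S c(W)` with `c = (p/n)(1 - a ψ)`. Scaling reduces to `σ = 1`, with `r = R/σ²`
as the quantity to be estimated, and the assumed domination gives `r ≤ p`. Where truncation acts, it
lowers `c` to `c' = p(1 + W)/N` with `N = n + p + 2`, so that `S c' = p T/N` with `T = ‖X‖² + S`.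
From `(S c - r)² - (S c' - r)² = S²(c - c')² + 2(c - c') S (S c' - r)` and `r ≤ p`, everything
follows from `E[k(W) S T] ≥ N E[k(W) S]` for `k = c - c' ≥ 0`.

For `θ = 0`, `T` is a `χ²` variable with `n + p` degrees of freedom independent of `W`, and
`E[T²]/E[T] = N`, so equality holds. For general `θ`, symmetrising the density in `x` turns the
dependence on `θ` into `cosh ⟨x, θ⟩`. The rest of the density is homogeneous apart from `exp(-T/2)`,
so a dilation by `c ≥ 1` only replaces `cosh ⟨x, θ⟩` by the smaller `cosh (⟨x, θ⟩/c)`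
(`pow_mul_lintegral_tilt_le`). Differentiating at `c = 1` gives the moment inequality
(`lintegral_snd_le`).

The remaining term `E[S²(c - c')²]` yields strictness: `a` is continuous, so a change at one point
persists on an open set, which `W` hits with positive probability (`gap_pos`). Both `ψ₁` and `ψ₂`
have the form `min (1, K/a)` with `K ≥ 0`, which keeps `a ψ` in `[0, K]` and the risks finite. -/

namespace ShrinkageMSE

noncomputable section

open Filter Topology

/-! ### Reduction to unit scale -/

/-- The joint law of `(X, S)` when `σ = 1`. -/
def unitLaw (p n : ℕ) (θ : Vec p) : Measure (Vec p × ℝ) :=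
  ((stdGaussian (Vec p)).map (fun x => θ + x)).prod (chiSq n)

/-- The scaling `(x, s) ↦ (c x, c² s)` of the sample space. -/
def scale {p : ℕ} (c : ℝ) (z : Vec p × ℝ) : Vec p × ℝ := (c • z.1, c ^ 2 * z.2)

@[fun_prop]
lemma measurable_scale {p : ℕ} (c : ℝ) : Measurable (scale (p := p) c) := by
  unfold scale; fun_prop

@[fun_prop]
lemma measurable_W {p : ℕ} : Measurable (W (p := p)) := by
  unfold W; fun_prop

lemma W_scale {p : ℕ} {c : ℝ} (hc : 0 < c) (z : Vec p × ℝ) : W (scale c z) = W z := by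
  have : c ^ 2 ≠ 0 := by positivity
  simp only [W, scale, norm_smul, Real.norm_eq_abs, mul_pow, sq_abs]
  exact mul_div_mul_left _ _ this

lemma isProbabilityMeasure_chiSq {n : ℕ} (hn : 1 ≤ n) : IsProbabilityMeasure (chiSq n) :=
  isProbabilityMeasure_gammaMeasure (by positivity) (by norm_num)

lemma isProbabilityMeasure_unitLaw {p n : ℕ} (hn : 1 ≤ n) (θ : Vec p) :
    IsProbabilityMeasure (unitLaw p n θ) := by
  have := isProbabilityMeasure_chiSq hn
  have : IsProbabilityMeasure ((stdGaussian (Vec p)).map (fun x => θ + x)) :=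
    Measure.isProbabilityMeasure_map (by fun_prop)
  unfold unitLaw
  infer_instance

open scoped MatrixOrder in
lemma sqrt_smul_one (p : ℕ) {σ : ℝ} (hσ : 0 ≤ σ) :
    CFC.sqrt (σ ^ 2 • (1 : Matrix (Fin p) (Fin p) ℝ)) = σ • 1 := by
  have h0 : (0 : Matrix (Fin p) (Fin p) ℝ) ≤ σ • 1 := by
    rw [Matrix.nonneg_iff_posSemidef]
    exact Matrix.PosSemidef.one.smul hσ
  refine CFC.sqrt_unique ?_ h0
  simp [smul_smul, sq]

lemma multivariateGaussian_smul_one (p : ℕ) (θ : Vec p) {σ : ℝ} (hσ : 0 ≤ σ) :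
    multivariateGaussian θ (σ ^ 2 • (1 : Matrix (Fin p) (Fin p) ℝ)) =
      (stdGaussian (Vec p)).map (fun x => θ + σ • x) := by
  rw [multivariateGaussian, sqrt_smul_one p hσ]
  simp

lemma modelLaw_eq_map {p n : ℕ} (hn : 1 ≤ n) (θ : Vec p) {σ : ℝ} (hσ : 0 < σ) :
    modelLaw p n θ σ = (unitLaw p n (σ⁻¹ • θ)).map (scale σ) := by
  have := isProbabilityMeasure_chiSq hn
  rw [modelLaw, unitLaw, multivariateGaussian_smul_one p θ hσ.le]
  have h1 : (stdGaussian (Vec p)).map (fun x => θ + σ • x) =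
      ((stdGaussian (Vec p)).map (fun x => σ⁻¹ • θ + x)).map (fun x => σ • x) := by
    rw [Measure.map_map (by fun_prop) (by fun_prop)]
    congr 1
    ext1 x
    simp [smul_smul, hσ.ne']
  have : IsProbabilityMeasure ((stdGaussian (Vec p)).map (fun x => σ⁻¹ • θ + x)) :=
    Measure.isProbabilityMeasure_map (by fun_prop)
  rw [h1, Measure.map_prod_map _ _ (by fun_prop) (by fun_prop)]
  rfl

/-! ### Densities, null sets and moments -/

/-- The normalising constant of the standard Gaussian density on `ℝᵖ`. -/
def gaussConst (p : ℕ) : ℝ := ((2 * Real.pi) ^ ((p : ℝ) / 2))⁻¹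

lemma gaussConst_pos (p : ℕ) : 0 < gaussConst p := by
  have := Real.pi_pos
  unfold gaussConst; positivity

lemma integrable_exp_neg_half_norm_sq (p : ℕ) :
    Integrable (fun x : Vec p => Real.exp (-‖x‖ ^ 2 / 2)) := by
  have := (GaussianFourier.integrable_cexp_neg_mul_sq_norm_add (V := Vec p) (b := 1 / 2)
    (by norm_num) 0 0).re
  refine this.congr (ae_of_all _ fun x => ?_)
  simp only [zero_mul, add_zero]
  rw [show (-(1 / 2) * (‖x‖ : ℂ) ^ 2) = ((-‖x‖ ^ 2 / 2 : ℝ) : ℂ) by push_cast; ring,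
    ← Complex.ofReal_exp]
  rfl

lemma stdGaussian_eq_withDensity (p : ℕ) :
    stdGaussian (Vec p) = volume.withDensity
      (fun x => ENNReal.ofReal (gaussConst p * Real.exp (-‖x‖ ^ 2 / 2))) := by
  have hint := (integrable_exp_neg_half_norm_sq p).const_mul (gaussConst p)
  have hfin : IsFiniteMeasure ((volume : Measure (Vec p)).withDensity
      (fun x => ENNReal.ofReal (gaussConst p * Real.exp (-‖x‖ ^ 2 / 2)))) :=
    isFiniteMeasure_withDensity_ofReal hint.2
  -- The density is identified by its Fourier transform.
  apply Measure.ext_of_charFun (E := Vec p)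
  ext t
  rw [charFun_stdGaussian, charFun_apply, integral_withDensity_eq_integral_toReal_smul₀
    (by fun_prop) (by simp)]
  have hC := gaussConst_pos p
  have h1 : ∀ x : Vec p, (ENNReal.ofReal (gaussConst p * Real.exp (-‖x‖ ^ 2 / 2))).toReal •
      Complex.exp (inner ℝ x t * Complex.I) =
      (gaussConst p : ℂ) * Complex.exp (-(1 / 2) * (‖x‖ : ℂ) ^ 2 + Complex.I * (inner ℝ t x : ℝ)) := by
    intro x
    rw [ENNReal.toReal_ofReal (by positivity), Complex.real_smul, real_inner_comm, Complex.ofReal_mul,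
      Complex.ofReal_exp, mul_assoc, ← Complex.exp_add]
    congr 2
    push_cast
    ring
  simp_rw [h1]
  rw [integral_const_mul, GaussianFourier.integral_cexp_neg_mul_sq_norm_add (by norm_num),
    ← mul_assoc]
  have h2 : (gaussConst p : ℂ) * ((Real.pi : ℂ) / (1 / 2)) ^ ((Module.finrank ℝ (Vec p) : ℂ) / 2) = 1 := by
    rw [gaussConst, show (Real.pi : ℂ) / (1 / 2) = ((2 * Real.pi : ℝ) : ℂ) by push_cast; ring,
      finrank_euclideanSpace_fin, show ((p : ℂ) / 2) = (((p : ℝ) / 2 : ℝ) : ℂ) by push_cast; ring,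
      ← Complex.ofReal_cpow (by positivity), ← Complex.ofReal_mul, inv_mul_cancel₀ (by positivity)]
    simp
  rw [h2, one_mul]
  congr 1
  rw [Complex.I_sq]
  ring

/-- The density of `unitLaw`. -/
def unitDensity (p n : ℕ) (θ : Vec p) (z : Vec p × ℝ) : ℝ≥0∞ :=
  ENNReal.ofReal (gaussConst p * Real.exp (-‖z.1 - θ‖ ^ 2 / 2)) * gammaPDF ((n : ℝ) / 2) (1 / 2) z.2

lemma measurable_gammaPDF (a r : ℝ) : Measurable (gammaPDF a r) :=
  (measurable_gammaPDFReal a r).ennreal_ofReal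

lemma measurable_unitDensity (p n : ℕ) (θ : Vec p) : Measurable (unitDensity p n θ) := by
  unfold unitDensity
  have := measurable_gammaPDF ((n : ℝ) / 2) (1 / 2)
  fun_prop

lemma unitLaw_eq_withDensity {p n : ℕ} (hn : 1 ≤ n) (θ : Vec p) :
    unitLaw p n θ = (volume : Measure (Vec p × ℝ)).withDensity (unitDensity p n θ) := by
  have h1 : (stdGaussian (Vec p)).map (fun x => θ + x) = volume.withDensity
      (fun x => ENNReal.ofReal (gaussConst p * Real.exp (-‖x - θ‖ ^ 2 / 2))) := by
    refine Measure.ext_of_lintegral _ fun f hf => ?_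
    rw [lintegral_map hf (by fun_prop), stdGaussian_eq_withDensity,
      lintegral_withDensity_eq_lintegral_mul _ (by fun_prop) (by fun_prop),
      lintegral_withDensity_eq_lintegral_mul _ (by fun_prop) hf,
      ← lintegral_add_left_eq_self
        ((fun x => ENNReal.ofReal (gaussConst p * Real.exp (-‖x - θ‖ ^ 2 / 2))) * f) θ]
    simp
  have h2 := isProbabilityMeasure_chiSq hn
  rw [unitLaw, h1, chiSq, gammaMeasure]
  have : SFinite ((volume : Measure ℝ).withDensity (gammaPDF ((n : ℝ) / 2) (1 / 2))) := by
    change SFinite (chiSq n); infer_instance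
  rw [prod_withDensity (by fun_prop) (measurable_gammaPDF _ _)]
  rfl

lemma ae_unitLaw_pos {p n : ℕ} (hp : 1 ≤ p) (hn : 1 ≤ n) (θ : Vec p) :
    ∀ᵐ z ∂unitLaw p n θ, 0 < z.2 ∧ 0 < W z := by
  have hne : Nonempty (Fin p) := ⟨⟨0, hp⟩⟩
  have hx : ∀ᵐ z : Vec p × ℝ, z.1 ≠ 0 :=
    Measure.quasiMeasurePreserving_fst.ae (p := fun x : Vec p => x ≠ 0) (by simp [ae_iff])
  have hs : ∀ᵐ z : Vec p × ℝ, z.2 ≠ 0 :=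
    Measure.quasiMeasurePreserving_snd.ae (p := fun x : ℝ => x ≠ 0) (by simp [ae_iff])
  rw [unitLaw_eq_withDensity hn, ae_withDensity_iff (measurable_unitDensity p n θ)]
  filter_upwards [hx, hs] with z hx hs hd
  have hpos : 0 < z.2 := by
    rcases hs.lt_or_gt with h | h
    · exact absurd (by simp [unitDensity, gammaPDF_of_neg h]) hd
    · exact h
  have := norm_pos_iff.2 hx
  exact ⟨hpos, by unfold W; positivity⟩

lemma unitLaw_pos_of_isOpen {p n : ℕ} (hn : 1 ≤ n) (θ : Vec p) {U : Set (Vec p × ℝ)}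
    (hU : IsOpen U) (hne : U.Nonempty) (hpos : ∀ z ∈ U, 0 < z.2) : 0 < unitLaw p n θ U := by
  rw [unitLaw_eq_withDensity hn, pos_iff_ne_zero, Ne,
    withDensity_apply_eq_zero (measurable_unitDensity p n θ)]
  have : {z | unitDensity p n θ z ≠ 0} ∩ U = U := by
    refine inter_eq_right.2 fun z hz => ?_
    have h1 := gaussConst_pos p
    have h2 := gammaPDFReal_pos (a := (n : ℝ) / 2) (r := 1 / 2) (by positivity) (by norm_num) (hpos z hz)
    simp only [unitDensity, gammaPDF, mem_ofPred_eq, ne_eq, mul_eq_zero, ENNReal.ofReal_eq_zero, not_or,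
      not_le]
    exact ⟨by positivity, h2⟩
  rw [this]
  exact (hU.measure_pos _ hne).ne'

lemma integrable_sq_chiSq {n : ℕ} (hn : 1 ≤ n) : Integrable (fun s : ℝ => s ^ 2) (chiSq n) := by
  have hpos : (0 : ℝ) < (n : ℝ) / 2 := by positivity
  rw [chiSq, gammaMeasure, integrable_withDensity_iff (measurable_gammaPDF _ _)
    (ae_of_all _ fun x => by simp [gammaPDF])]
  have h := integrableOn_rpow_mul_exp_neg_mul_rpow (s := (n : ℝ) / 2 + 1) (p := 1) (b := 1 / 2)
    (by linarith) one_pos (by norm_num)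
  have h2 := (integrable_indicator_iff measurableSet_Ioi).2
    (Integrable.const_mul h ((1 / 2 : ℝ) ^ ((n : ℝ) / 2) / Real.Gamma ((n : ℝ) / 2)))
  refine h2.congr (ae_of_all _ fun x => ?_)
  beta_reduce
  by_cases hx : 0 < x
  · rw [indicator_of_mem (mem_Ioi.2 hx), gammaPDF,
      ENNReal.toReal_ofReal (gammaPDFReal_nonneg hpos (by norm_num) x), gammaPDFReal, if_pos hx.le,
      show (n : ℝ) / 2 + 1 = ((n : ℝ) / 2 - 1) + (2 : ℕ) by push_cast; ring, Real.rpow_add_natCast hx.ne',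
      Real.rpow_one, neg_mul]
    ring
  · rw [indicator_of_notMem (by simpa using hx)]
    rcases (not_lt.1 hx).lt_or_eq with h | rfl
    · simp [gammaPDF_of_neg h]
    · simp

lemma integrable_sq_snd_unitLaw {p n : ℕ} (hn : 1 ≤ n) (θ : Vec p) :
    Integrable (fun z : Vec p × ℝ => z.2 ^ 2) (unitLaw p n θ) := by
  have := isProbabilityMeasure_chiSq hn
  have : IsProbabilityMeasure ((stdGaussian (Vec p)).map (fun x => θ + x)) :=
    Measure.isProbabilityMeasure_map (by fun_prop)
  exact (integrable_sq_chiSq hn).comp_snd _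

lemma lintegral_sq_norm_stdGaussian (p : ℕ) :
    ∫⁻ x, ENNReal.ofReal (‖x‖ ^ 2) ∂stdGaussian (Vec p) = p := by
  have h1 : ∀ i : Fin p, ∫⁻ x : Vec p, ENNReal.ofReal (x i ^ 2) ∂stdGaussian (Vec p) = 1 := by
    intro i
    have h := measurePreserving_eval_multivariateGaussian (μ := (0 : Vec p))
      (S := (1 : Matrix (Fin p) (Fin p) ℝ)) Matrix.PosSemidef.one (i := i)
    rw [multivariateGaussian_zero_one] at h
    rw [h.lintegral_comp (f := fun y : ℝ => ENNReal.ofReal (y ^ 2)) (by fun_prop)]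
    simp only [PiLp.zero_apply, Matrix.one_apply_eq, Real.toNNReal_one]
    have hm : MemLp (id : ℝ → ℝ) 2 (gaussianReal 0 1) := IsGaussian.memLp_two_id
    have hv := variance_id_gaussianReal (μ := 0) (v := 1)
    rw [variance_eq_sub hm] at hv
    simp only [integral_id_gaussianReal, id, Pi.pow_apply] at hv
    rw [← ofReal_integral_eq_lintegral_ofReal
      (show Integrable (fun x : ℝ => x ^ 2) _ from hm.integrable_sq)
      (ae_of_all _ fun x => by positivity)]
    simp_all
  simp_rw [EuclideanSpace.real_norm_sq_eq]
  simp_rw [ENNReal.ofReal_sum_of_nonneg (fun i _ => sq_nonneg _)]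
  rw [lintegral_finsetSum _ (by fun_prop)]
  simp [h1]

lemma mse_id {p n : ℕ} (hn : 1 ≤ n) (θ : Vec p) {σ : ℝ} (hσ : 0 < σ) :
    mse p n (fun z => z.1) θ σ = ENNReal.ofReal (p * σ ^ 2) := by
  have := isProbabilityMeasure_chiSq hn
  have : IsProbabilityMeasure ((chiSq n).map (fun u => σ ^ 2 * u)) :=
    Measure.isProbabilityMeasure_map (by fun_prop)
  rw [mse, modelLaw, multivariateGaussian_smul_one p θ hσ.le]
  have : IsProbabilityMeasure ((stdGaussian (Vec p)).map (fun x => θ + σ • x)) :=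
    Measure.isProbabilityMeasure_map (by fun_prop)
  rw [lintegral_prod _ (by fun_prop)]
  simp only [lintegral_const, measure_univ, mul_one]
  rw [lintegral_map (by fun_prop) (by fun_prop)]
  simp only [add_sub_cancel_left, norm_smul, mul_pow, Real.norm_eq_abs, sq_abs]
  simp_rw [ENNReal.ofReal_mul (sq_nonneg σ)]
  rw [lintegral_const_mul _ (by fun_prop), lintegral_sq_norm_stdGaussian,
    ENNReal.ofReal_mul (by positivity), mul_comm, ENNReal.ofReal_natCast]

/-! ### The moment inequality by dilation -/

lemma lintegral_comp_scale {p : ℕ} {c : ℝ} (hc : 0 < c) {F : Vec p × ℝ → ℝ≥0∞} (hF : Measurable F) :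
    ENNReal.ofReal (c ^ (p + 2)) * ∫⁻ z, F (scale c z) = ∫⁻ z, F z := by
  have h1 : (volume : Measure (Vec p)).map (c • ·) =
      ENNReal.ofReal (c ^ p)⁻¹ • (volume : Measure (Vec p)) := by
    rw [Measure.map_addHaar_smul _ hc.ne', finrank_euclideanSpace_fin, abs_of_pos (by positivity)]
  have h2 : (volume : Measure ℝ).map (c ^ 2 * ·) = ENNReal.ofReal (c ^ 2)⁻¹ • (volume : Measure ℝ) := by
    rw [Real.map_volume_mul_left (by positivity), abs_of_pos (by positivity)]
  have h3 : (volume : Measure (Vec p × ℝ)).map (scale c) =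
      ENNReal.ofReal (c ^ (p + 2))⁻¹ • (volume : Measure (Vec p × ℝ)) := by
    rw [Measure.volume_eq_prod]
    have hs1 : SFinite ((volume : Measure (Vec p)).map (c • ·)) := inferInstance
    have hs2 : SFinite ((volume : Measure ℝ).map (c ^ 2 * ·)) := inferInstance
    have := Measure.map_prod_map (volume : Measure (Vec p)) (volume : Measure ℝ)
      (f := (c • ·)) (g := (c ^ 2 * ·)) (by fun_prop) (by fun_prop)
    rw [h1, h2, Measure.prod_smul_left, Measure.prod_smul_right, smul_smul,
      ← ENNReal.ofReal_mul (by positivity)] at this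
    rw [pow_add, mul_inv, this]
    rfl
  rw [← lintegral_map hF (measurable_scale c), h3, lintegral_smul_measure, smul_eq_mul, ← mul_assoc,
    ← ENNReal.ofReal_mul (by positivity), mul_inv_cancel₀ (by positivity), ENNReal.ofReal_one, one_mul]

lemma lintegral_comp_neg_fst {p : ℕ} {F : Vec p × ℝ → ℝ≥0∞} (hF : Measurable F) :
    ∫⁻ z : Vec p × ℝ, F (-z.1, z.2) = ∫⁻ z, F z := by
  have h : MeasurePreserving (Prod.map (fun x : Vec p => -x) (id : ℝ → ℝ)) volume volume :=
    (Measure.measurePreserving_neg (volume : Measure (Vec p))).prod (MeasurePreserving.id volume)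
  exact h.lintegral_comp hF

/-- Sum of squares `‖x‖² + s`. -/
def total {p : ℕ} (z : Vec p × ℝ) : ℝ := ‖z.1‖ ^ 2 + z.2

@[fun_prop]
lemma measurable_total {p : ℕ} : Measurable (total (p := p)) := by
  unfold total; fun_prop

/-- The part of the density of `(X, S)`, multiplied by `s`, which is homogeneous under `scale`. -/
def homPart (n : ℕ) (s : ℝ) : ℝ :=
  s * (gammaPDFReal ((n : ℝ) / 2) (1 / 2) s * Real.exp (s / 2))

@[fun_prop]
lemma measurable_homPart (n : ℕ) : Measurable (homPart n) := by
  unfold homPart; fun_prop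

lemma homPart_nonneg {n : ℕ} (hn : 1 ≤ n) (s : ℝ) : 0 ≤ homPart n s := by
  rcases le_or_gt 0 s with h | h
  · have := gammaPDFReal_nonneg (a := (n : ℝ) / 2) (r := 1 / 2) (by positivity) (by norm_num) s
    unfold homPart; positivity
  · simp [homPart, gammaPDFReal, not_le.2 h]

lemma homPart_sq_mul (n : ℕ) {c : ℝ} (hc : 0 < c) (s : ℝ) :
    homPart n (c ^ 2 * s) = c ^ n * homPart n s := by
  rcases lt_trichotomy s 0 with h | rfl | h
  · have : c ^ 2 * s < 0 := mul_neg_of_pos_of_neg (by positivity) h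
    simp [homPart, gammaPDFReal, not_le.2 h, not_le.2 this]
  · simp [homPart]
  · have h2 : 0 < c ^ 2 * s := by positivity
    have h3 : c ^ 2 * (c ^ 2) ^ ((n : ℝ) / 2 - 1) = c ^ n := by
      rw [Real.rpow_sub_one (by positivity), mul_div_cancel₀ _ (by positivity), ← Real.rpow_natCast,
        ← Real.rpow_mul hc.le, ← Real.rpow_natCast]
      congr 1
      push_cast
      ring
    have h4 : ∀ t : ℝ, Real.exp (-(1 / 2 * t)) * Real.exp (t / 2) = 1 := by
      intro t
      rw [← Real.exp_add, Real.exp_eq_one_iff]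
      ring
    simp only [homPart, gammaPDFReal, if_pos h.le, if_pos h2.le]
    rw [mul_assoc _ (Real.exp _), h4, mul_assoc _ (Real.exp _), h4, ← h3,
      Real.mul_rpow (by positivity) h.le]
    ring

/-- Expectations of `k(W) S exp(-(c² - 1)(‖X‖² + S)/2)` as symmetrised Lebesgue integrals. -/
lemma lintegral_unitLaw_tilt {p n : ℕ} (hn : 1 ≤ n) (θ : Vec p) {k : ℝ → ℝ≥0∞} (hk : Measurable k)
    (c : ℝ) :
    ∫⁻ z, k (W z) * ENNReal.ofReal (z.2 * Real.exp (-((c ^ 2 - 1) * total z / 2))) ∂unitLaw p n θ =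
      ENNReal.ofReal (gaussConst p * Real.exp (-‖θ‖ ^ 2 / 2)) *
        ∫⁻ z, k (W z) * ENNReal.ofReal
          (homPart n z.2 * Real.exp (-(c ^ 2 * total z / 2)) * Real.cosh (inner ℝ z.1 θ)) := by
  have hC := gaussConst_pos p
  set G : Vec p × ℝ → ℝ≥0∞ := fun z => k (W z) * ENNReal.ofReal
    (homPart n z.2 * Real.exp (-(c ^ 2 * total z / 2)) * (Real.exp (inner ℝ z.1 θ) / 2)) with hG
  have hGm : Measurable G := by fun_prop
  have hsym : ∫⁻ z, k (W z) * ENNReal.ofReal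
      (homPart n z.2 * Real.exp (-(c ^ 2 * total z / 2)) * Real.cosh (inner ℝ z.1 θ)) =
      ENNReal.ofReal 2 * ∫⁻ z, G z := by
    rw [ENNReal.ofReal_ofNat, two_mul]
    -- Reflecting `x` in one of the two copies makes the exponentials add up to `cosh`.
    nth_rewrite 2 [← lintegral_comp_neg_fst hGm]
    rw [← lintegral_add_left hGm]
    refine lintegral_congr fun z => ?_
    have h0 := homPart_nonneg hn z.2
    simp only [hG, W, total, norm_neg, inner_neg_left]
    rw [← mul_add, ← ENNReal.ofReal_add (by positivity) (by positivity), Real.cosh_eq]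
    congr 2
    ring
  rw [hsym, unitLaw_eq_withDensity hn, lintegral_withDensity_eq_lintegral_mul _
    (measurable_unitDensity p n θ) (by fun_prop), ← mul_assoc,
    ← lintegral_const_mul _ hGm]
  refine lintegral_congr fun z => ?_
  have h0 := homPart_nonneg hn z.2
  have hg := gammaPDFReal_nonneg (a := (n : ℝ) / 2) (r := 1 / 2) (by positivity) (by norm_num) z.2
  simp only [hG, Pi.mul_apply, unitDensity, gammaPDF]
  rw [mul_left_comm, mul_left_comm _ (k (W z)),
    ← ENNReal.ofReal_mul (by positivity), ← ENNReal.ofReal_mul (by positivity),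
    ← ENNReal.ofReal_mul (by positivity), ← ENNReal.ofReal_mul (by positivity)]
  congr 2
  have h5 : Real.exp (-‖z.1 - θ‖ ^ 2 / 2) * Real.exp (-((c ^ 2 - 1) * total z / 2)) =
      Real.exp (-‖θ‖ ^ 2 / 2) * Real.exp (-(c ^ 2 * total z / 2)) * Real.exp (inner ℝ z.1 θ) *
        Real.exp (z.2 / 2) := by
    rw [← Real.exp_add, ← Real.exp_add, ← Real.exp_add, ← Real.exp_add, norm_sub_sq_real, total]
    congr 1
    ring
  simp only [homPart]
  linear_combination gaussConst p * gammaPDFReal ((n : ℝ) / 2) (1 / 2) z.2 * z.2 * h5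

/-- The scaling inequality from which the conditional moment bound is derived. -/
lemma pow_mul_lintegral_tilt_le {p n : ℕ} (hn : 1 ≤ n) (θ : Vec p) {k : ℝ → ℝ≥0∞}
    (hk : Measurable k) {c : ℝ} (hc : 1 ≤ c) :
    ENNReal.ofReal (c ^ (n + p + 2)) *
      ∫⁻ z, k (W z) * ENNReal.ofReal (z.2 * Real.exp (-((c ^ 2 - 1) * total z / 2))) ∂unitLaw p n θ ≤
      ∫⁻ z, k (W z) * ENNReal.ofReal z.2 ∂unitLaw p n θ := by
  have hc0 : 0 < c := by linarith
  have h1 := lintegral_unitLaw_tilt (p := p) hn θ hk 1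
  simp only [one_pow, sub_self, zero_mul, zero_div, neg_zero, Real.exp_zero, mul_one] at h1
  rw [h1, lintegral_unitLaw_tilt hn θ hk c, mul_left_comm]
  gcongr
  -- The factor `c ^ (n + p + 2)` is the Jacobian `c ^ (p + 2)` times the `c ^ n` from `homPart`;
  -- after the dilation, `c` survives only inside `cosh`.
  set F : Vec p × ℝ → ℝ≥0∞ := fun z => k (W z) * ENNReal.ofReal
    (homPart n z.2 * Real.exp (-(1 * total z / 2)) * Real.cosh (c⁻¹ * inner ℝ z.1 θ)) with hF
  have hFm : Measurable F := by fun_prop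
  have h2 : ENNReal.ofReal (c ^ (n + p + 2)) * ∫⁻ z, k (W z) * ENNReal.ofReal
      (homPart n z.2 * Real.exp (-(c ^ 2 * total z / 2)) * Real.cosh (inner ℝ z.1 θ)) =
      ∫⁻ z, F z := by
    rw [← lintegral_comp_scale hc0 hFm, add_assoc, pow_add, mul_comm (c ^ n),
      ENNReal.ofReal_mul (by positivity), mul_assoc, ← lintegral_const_mul _ (by fun_prop)]
    congr 1
    refine lintegral_congr fun z => ?_
    simp only [hF]
    rw [W_scale hc0, mul_left_comm, ← ENNReal.ofReal_mul (by positivity)]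
    congr 2
    simp only [scale, total, homPart_sq_mul n hc0, real_inner_smul_left, norm_smul, mul_pow,
      Real.norm_eq_abs, sq_abs, inv_mul_cancel_left₀ hc0.ne', one_mul, ← mul_add]
    ring
  rw [h2]
  refine lintegral_mono fun z => ?_
  have h0 := homPart_nonneg hn z.2
  simp only [hF, one_mul]
  gcongr
  rw [Real.cosh_le_cosh, abs_mul, abs_of_pos (by positivity : 0 < c⁻¹)]
  exact mul_le_of_le_one_left (abs_nonneg _) (inv_le_one_of_one_le₀ hc)

/-- The inequality `pow_mul_lintegral_tilt_le` is an equality at `c = 1`, so formally the right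
derivative of its left side there, `N E[k S] - E[k S T]`, is at most `0`. Finiteness of `E[k S]`
allows the subtraction. -/
lemma lintegral_snd_le {p n : ℕ} (hp : 1 ≤ p) (hn : 1 ≤ n) (θ : Vec p) {k : ℝ → ℝ≥0∞}
    (hk : Measurable k) (hfin : ∫⁻ z, k (W z) * ENNReal.ofReal z.2 ∂unitLaw p n θ ≠ ∞) :
    ((n + p + 2 : ℕ) : ℝ≥0∞) * ∫⁻ z, k (W z) * ENNReal.ofReal z.2 ∂unitLaw p n θ ≤
      ∫⁻ z, k (W z) * ENNReal.ofReal (z.2 * total z) ∂unitLaw p n θ := by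
  set A := ∫⁻ z, k (W z) * ENNReal.ofReal z.2 ∂unitLaw p n θ with hA
  set B := ∫⁻ z, k (W z) * ENNReal.ofReal (z.2 * total z) ∂unitLaw p n θ with hB
  rcases eq_or_ne B ∞ with hBt | hBt
  · rw [hBt]; exact le_top
  -- A difference quotient replaces the derivative: `c ^ N` is bounded below by Bernoulli's
  -- inequality and the tilt by `1 - u ≤ exp (-u)`.
  have key : ∀ ε : ℝ, 0 < ε →
      ((n + p + 2 : ℕ) : ℝ) * A.toReal ≤ (1 + ε) ^ (n + p + 2) * (1 + ε / 2) * B.toReal := by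
    intro ε hε
    set c := 1 + ε with hc
    set N := n + p + 2
    have hcN : (0 : ℝ) < c ^ N := by positivity
    have hδ : 0 < c ^ 2 - 1 := by rw [hc]; nlinarith
    have h1 := pow_mul_lintegral_tilt_le (p := p) hn θ hk (c := c) (by linarith)
    set E := ∫⁻ z, k (W z) * ENNReal.ofReal (z.2 * Real.exp (-((c ^ 2 - 1) * total z / 2)))
      ∂unitLaw p n θ with hE
    have h2 : A ≤ E + ENNReal.ofReal ((c ^ 2 - 1) / 2) * B := by
      rw [hA, hE, hB, ← lintegral_const_mul _ (by fun_prop), ← lintegral_add_left (by fun_prop)]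
      refine lintegral_mono_ae ?_
      filter_upwards [ae_unitLaw_pos hp hn θ] with z hz
      have hs := hz.1
      have ht : 0 ≤ total z := by unfold total; positivity
      rw [mul_left_comm, ← mul_add, ← ENNReal.ofReal_mul (by positivity),
        ← ENNReal.ofReal_add (by positivity) (by positivity)]
      gcongr
      have := Real.add_one_le_exp (-((c ^ 2 - 1) * total z / 2))
      nlinarith
    have hEt : E ≠ ∞ := by
      intro hE
      rw [hE, ENNReal.mul_top (by simpa using hcN)] at h1
      exact hfin (top_le_iff.1 h1)
    have h1' : c ^ N * E.toReal ≤ A.toReal := by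
      have := ENNReal.toReal_mono hfin h1
      rwa [ENNReal.toReal_mul, ENNReal.toReal_ofReal hcN.le] at this
    have h2' : A.toReal ≤ E.toReal + (c ^ 2 - 1) / 2 * B.toReal := by
      have := ENNReal.toReal_mono (by finiteness) h2
      rwa [ENNReal.toReal_add hEt (by finiteness), ENNReal.toReal_mul,
        ENNReal.toReal_ofReal (by positivity)] at this
    have h3 : 1 + (N : ℝ) * ε ≤ c ^ N := one_add_mul_le_pow (by linarith) N
    have h4 : ε * (N * A.toReal) ≤ ε * (c ^ N * (1 + ε / 2) * B.toReal) := by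
      have h5 := mul_le_mul_of_nonneg_right h3 (ENNReal.toReal_nonneg (a := A))
      have h6 := mul_le_mul_of_nonneg_left h2' hcN.le
      have h7 : c ^ 2 - 1 = ε * (2 + ε) := by rw [hc]; ring
      rw [h7] at h6
      nlinarith
    exact le_of_mul_le_mul_left h4 hε
  have hlim : Tendsto (fun ε : ℝ => (1 + ε) ^ (n + p + 2) * (1 + ε / 2) * B.toReal) (𝓝[>] 0)
      (𝓝 B.toReal) := by
    have : Continuous (fun ε : ℝ => (1 + ε) ^ (n + p + 2) * (1 + ε / 2) * B.toReal) := by fun_prop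
    simpa using (this.tendsto 0).mono_left nhdsWithin_le_nhds
  have hreal : ((n + p + 2 : ℕ) : ℝ) * A.toReal ≤ B.toReal :=
    ge_of_tendsto hlim (eventually_mem_nhdsWithin.mono fun ε hε => key ε hε)
  rw [← ENNReal.toReal_le_toReal (by finiteness) hBt, ENNReal.toReal_mul, ENNReal.toReal_natCast]
  exact hreal

lemma lintegral_sq_add_const_lt_top {p n : ℕ} (hn : 1 ≤ n) (θ : Vec p) (b d : ℝ) :
    ∫⁻ z, ENNReal.ofReal (b * z.2 ^ 2 + d) ∂unitLaw p n θ < ∞ := by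
  have := isProbabilityMeasure_unitLaw hn θ
  exact (((integrable_sq_snd_unitLaw hn θ).const_mul b).add (integrable_const d)).lintegral_lt_top

/-! ### Comparison of risks -/

/-- Lowering `c` to `p (1 + w) / (n + p + 2)` reduces the risk of `S c(W)` as an estimator of
`r ≤ p`, by at least the expected squared change. -/
lemma risk_add_gap_le {p n : ℕ} (hp : 1 ≤ p) (hn : 1 ≤ n) (θ : Vec p) {c c' : ℝ → ℝ}
    (hc : Measurable c) (hc' : Measurable c') {M : ℝ}
    (hM : ∀ w, 0 < w → |c w| ≤ M ∧ |c' w| ≤ M) (hle : ∀ w, 0 < w → c' w ≤ c w)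
    (heq : ∀ w, 0 < w → c' w ≠ c w → c' w = p * (1 + w) / (n + p + 2 : ℕ)) {r : ℝ} (hr : r ≤ p) :
    ∫⁻ z, ENNReal.ofReal ((z.2 * c' (W z) - r) ^ 2) ∂unitLaw p n θ +
      ∫⁻ z, ENNReal.ofReal ((z.2 * (c (W z) - c' (W z))) ^ 2) ∂unitLaw p n θ ≤
      ∫⁻ z, ENNReal.ofReal ((z.2 * c (W z) - r) ^ 2) ∂unitLaw p n θ := by
  set k : ℝ → ℝ≥0∞ := fun w => ENNReal.ofReal (c w - c' w) with hk
  have hkm : Measurable k := by fun_prop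
  set A := ∫⁻ z, k (W z) * ENNReal.ofReal z.2 ∂unitLaw p n θ with hA
  have hAt : A ≠ ∞ := by
    refine ((lintegral_mono_ae ?_).trans_lt
      (lintegral_sq_add_const_lt_top hn θ M M)).ne
    filter_upwards [ae_unitLaw_pos hp hn θ] with z ⟨hs, hw⟩
    obtain ⟨h1, h2⟩ := hM _ hw
    have h3 := hle _ hw
    rw [abs_le] at h1 h2
    rw [hk, ← ENNReal.ofReal_mul (by linarith)]
    refine ENNReal.ofReal_le_ofReal ?_
    have h4 : (c (W z) - c' (W z)) * z.2 ≤ 2 * M * z.2 := by gcongr; linarith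
    -- `2 M s ≤ M s² + M`, and the second moment of `S` is finite.
    nlinarith [mul_nonneg (show 0 ≤ M by linarith) (sq_nonneg (z.2 - 1))]
  have hkey := lintegral_snd_le hp hn θ hkm hAt
  set N := n + p + 2 with hN
  have hN0 : (0 : ℝ) < (N : ℕ) := by positivity
  have hpt : ∫⁻ z, ENNReal.ofReal ((z.2 * c' (W z) - r) ^ 2) ∂unitLaw p n θ +
      ∫⁻ z, ENNReal.ofReal ((z.2 * (c (W z) - c' (W z))) ^ 2) ∂unitLaw p n θ +
      ENNReal.ofReal (2 * p / N) *
        ∫⁻ z, k (W z) * ENNReal.ofReal (z.2 * total z) ∂unitLaw p n θ ≤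
      ∫⁻ z, ENNReal.ofReal ((z.2 * c (W z) - r) ^ 2) ∂unitLaw p n θ + ENNReal.ofReal (2 * p) * A := by
    rw [hA, ← lintegral_const_mul _ (by fun_prop), ← lintegral_const_mul _ (by fun_prop),
      ← lintegral_add_left (by fun_prop), ← lintegral_add_left (by fun_prop),
      ← lintegral_add_left (by fun_prop)]
    refine lintegral_mono_ae ?_
    filter_upwards [ae_unitLaw_pos hp hn θ] with z ⟨hs, hw⟩
    have h3 : 0 ≤ c (W z) - c' (W z) := sub_nonneg.2 (hle _ hw)
    have ht : 0 ≤ total z := by unfold total; positivity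
    rw [hk, ← ENNReal.ofReal_mul h3, ← ENNReal.ofReal_mul h3, ← ENNReal.ofReal_mul (by positivity),
      ← ENNReal.ofReal_mul (by positivity), ← ENNReal.ofReal_add (by positivity) (by positivity),
      ← ENNReal.ofReal_add (by positivity) (by positivity),
      ← ENNReal.ofReal_add (by positivity) (by positivity)]
    refine ENNReal.ofReal_le_ofReal ?_
    -- Where `c' ≠ c`, `S c'(W) = p T/N` because `S (1 + W) = T`; elsewhere both sides vanish.
    have h4 : (c (W z) - c' (W z)) * (c' (W z) * z.2) = (c (W z) - c' (W z)) * (p * total z / N) := by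
      by_cases h : c' (W z) = c (W z)
      · simp [h]
      · rw [heq _ hw h]
        congr 1
        rw [div_mul_eq_mul_div, mul_assoc, total, W]
        congr 2
        field_simp
        ring
    have h5 : 0 ≤ (c (W z) - c' (W z)) * z.2 * (p - r) :=
      mul_nonneg (by positivity) (sub_nonneg.2 hr)
    have h6 : 2 * p / N * ((c (W z) - c' (W z)) * (z.2 * total z)) =
        2 * z.2 * ((c (W z) - c' (W z)) * (p * total z / N)) := by ring
    rw [h6, ← h4]
    nlinarith
  have hpN : ENNReal.ofReal (2 * p) * A ≤ ENNReal.ofReal (2 * p / N) *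
        ∫⁻ z, k (W z) * ENNReal.ofReal (z.2 * total z) ∂unitLaw p n θ := by
    refine le_trans (le_of_eq ?_) (mul_le_mul_right hkey _)
    rw [← mul_assoc, ← ENNReal.ofReal_natCast N, ← ENNReal.ofReal_mul (by positivity),
      div_mul_cancel₀ _ hN0.ne']
  -- The other integrals are not known to be finite, so only this term is cancelled.
  have hfin : ENNReal.ofReal (2 * p) * A ≠ ∞ := by finiteness
  exact (ENNReal.add_le_add_iff_right hfin).1 ((add_le_add_right hpN _).trans hpt)

lemma lintegral_risk_lt_top {p n : ℕ} (hp : 1 ≤ p) (hn : 1 ≤ n) (θ : Vec p) {c : ℝ → ℝ} {M : ℝ}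
    (hM : ∀ w, 0 < w → |c w| ≤ M) (r : ℝ) :
    ∫⁻ z, ENNReal.ofReal ((z.2 * c (W z) - r) ^ 2) ∂unitLaw p n θ < ∞ := by
  refine (lintegral_mono_ae ?_).trans_lt
    (lintegral_sq_add_const_lt_top hn θ (2 * M ^ 2) (2 * r ^ 2))
  filter_upwards [ae_unitLaw_pos hp hn θ] with z ⟨hs, hw⟩
  refine ENNReal.ofReal_le_ofReal ?_
  have h1 : c (W z) ^ 2 ≤ M ^ 2 := sq_le_sq' (abs_le.1 (hM _ hw)).1 (abs_le.1 (hM _ hw)).2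
  nlinarith [sq_nonneg (z.2 * c (W z) + r), mul_le_mul_of_nonneg_right h1 (sq_nonneg z.2)]

/-- `W` is continuous on `{s > 0}` and takes every positive value there, so the integrand is
positive on a nonempty open set, on which the density is positive. -/
lemma gap_pos {p n : ℕ} (hp : 1 ≤ p) (hn : 1 ≤ n) (θ : Vec p) {d : ℝ → ℝ} (hd : Measurable d)
    {w : ℝ} (hw : 0 < w) (hne : ∀ᶠ v in 𝓝 w, d v ≠ 0) :
    0 < ∫⁻ z, ENNReal.ofReal ((z.2 * d (W z)) ^ 2) ∂unitLaw p n θ := by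
  obtain ⟨V, hV, hVo, hwV⟩ := eventually_nhds_iff.1 hne
  rw [lintegral_pos_iff_support (by fun_prop)]
  have hcont : ContinuousOn (W (p := p)) {z | 0 < z.2} := by
    unfold W
    exact ContinuousOn.div (by fun_prop) (by fun_prop) fun z hz => ne_of_gt hz
  have hO : IsOpen {z : Vec p × ℝ | 0 < z.2} := isOpen_lt continuous_const continuous_snd
  have hU := hcont.isOpen_inter_preimage hO hVo
  refine (unitLaw_pos_of_isOpen hn θ hU ?_ fun z hz => hz.1).trans_le (measure_mono ?_)
  · refine ⟨(EuclideanSpace.single ⟨0, hp⟩ (Real.sqrt w), 1), by simp, ?_⟩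
    simpa [W, Real.sq_sqrt hw.le] using hwV
  · rintro z ⟨hz, hzV⟩
    have h1 := hV _ hzV
    have h2 : z.2 ≠ 0 := ne_of_gt hz
    rw [Function.mem_support, Ne, ENNReal.ofReal_eq_zero, not_le]
    positivity

/-- An embedding allows a change of variables in `risk` without measurability of the integrand,
since `φ` is arbitrary outside `(0, ∞)`. -/
lemma measurableEmbedding_scale {p : ℕ} {c : ℝ} (hc : 0 < c) :
    MeasurableEmbedding (scale (p := p) c) :=
  (measurableEmbedding_const_smul₀ hc.ne').prodMap (measurableEmbedding_mulLeft₀ (by positivity))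

/-- The factor `(p / n) (1 - q)` of `S` in the estimator `Rhat`, where `q` is the value of `a ψ`. -/
def factor (p n : ℕ) (q : ℝ) : ℝ := (p : ℝ) / n * (1 - q)

lemma risk_eq {p n : ℕ} (hn : 1 ≤ n) (φ ψ : ℝ → ℝ) (θ : Vec p) {σ : ℝ} (hσ : 0 < σ) :
    risk p n φ ψ θ σ = ENNReal.ofReal (σ ^ 4) *
      ∫⁻ z, ENNReal.ofReal ((z.2 * factor p n (a p n φ (W z) * ψ (W z)) -
        R p n φ θ σ / σ ^ 2) ^ 2) ∂unitLaw p n (σ⁻¹ • θ) := by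
  rw [risk, modelLaw_eq_map hn θ hσ, (measurableEmbedding_scale hσ).lintegral_map,
    ← lintegral_const_mul' _ _ (by finiteness)]
  refine lintegral_congr fun z => ?_
  rw [← ENNReal.ofReal_mul (by positivity), Rhat, W_scale hσ, factor, scale]
  congr 1
  field_simp

lemma R_le {p n : ℕ} (hn : 1 ≤ n) {φ : ℝ → ℝ}
    (hδ : ∀ (θ : Vec p) (σ : ℝ), 0 < σ →
      mse p n (shrink φ) θ σ ≤ mse p n (fun z => z.1) θ σ) (θ : Vec p) {σ : ℝ} (hσ : 0 < σ) :
    R p n φ θ σ ≤ p * σ ^ 2 := by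
  refine ENNReal.toReal_le_of_le_ofReal (by positivity) ?_
  rw [← mse_id hn θ hσ]
  exact hδ θ σ hσ

/-- The derivative of `φ` enters only under a tail integral, so its own continuity is not needed. -/
lemma continuousOn_a {p n : ℕ} {φ : ℝ → ℝ} (hφ : ContinuousOn φ (Ioi 0))
    (hg : ∀ w : ℝ, 0 < w → IntegrableOn (gIntegrand p n φ) (Ioi w)) :
    ContinuousOn (a p n φ) (Ioi 0) := by
  have hprim : ContinuousOn (fun w => ∫ t in Ioi w, gIntegrand p n φ t) (Ioi 0) := by
    intro w (hw : 0 < w)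
    have h := IntegrableOn.continuousOn_Ici_primitive_Ioi (hg (w / 2) (by positivity))
    exact (h.continuousAt (Ici_mem_nhds (by linarith))).continuousWithinAt
  have hpow : ContinuousOn (fun w : ℝ => w ^ ((n : ℝ) / 2)) (Ioi 0) :=
    continuousOn_id.rpow_const fun w hw => Or.inl (ne_of_gt hw)
  exact continuousOn_const.mul ((hpow.mul hprim).sub
    ((hφ.pow 2).div continuousOn_id fun w hw => ne_of_gt hw))

/-! ### Clipping, truncation and the conclusion -/

/-- The product `a · min (1, K / a)`, as a function of the value of `a`. -/
def clip (K x : ℝ) : ℝ := x * min 1 (K / x)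

/-- For `x < 0` the minimum is `K / x`, so the product is exactly `K`; for `x > 0` it is `min x K`.
Thus `a ψ` is bounded whatever the sign or size of `a`. -/
lemma clip_mem_Icc {K : ℝ} (hK : 0 ≤ K) (x : ℝ) : clip K x ∈ Icc 0 K := by
  rcases lt_trichotomy x 0 with hx | rfl | hx
  · have : K / x ≤ 0 := div_nonpos_of_nonneg_of_nonpos hK hx.le
    rw [clip, min_eq_right (by linarith), mul_div_cancel₀ _ hx.ne]
    exact ⟨hK, le_rfl⟩
  · simpa [clip] using hK
  · rw [clip, mul_min_of_nonneg _ _ hx.le, mul_div_cancel₀ _ hx.ne', mul_one]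
    exact ⟨le_min hx.le hK, min_le_right _ _⟩

/-- The bound on `a ψ` imposed by the truncation. -/
def truncBound (p n : ℕ) (w : ℝ) : ℝ := 1 - (n : ℝ) * (1 + w) / ((n : ℝ) + p + 2)

/-- The product `a · ψ^{TR}` for `ψ = min (1, K / a)`, as a function of the value of `a`. -/
def truncClip (p n : ℕ) (K x w : ℝ) : ℝ :=
  if 0 < x then max (clip K x) (truncBound p n w) else clip K x

lemma mul_trunc (p n : ℕ) (φ : ℝ → ℝ) (K w : ℝ) :
    a p n φ w * trunc p n φ (fun w => min 1 (K / a p n φ w)) w =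
      truncClip p n K (a p n φ w) w := by
  unfold trunc truncClip clip truncBound lower
  split_ifs with h
  · rw [mul_max_of_nonneg _ _ h.le, ← mul_assoc, mul_one_div_cancel h.ne', one_mul]
  · rfl

lemma measurable_clip (K : ℝ) {A : ℝ → ℝ} (hA : Measurable A) :
    Measurable fun w => clip K (A w) := by
  unfold clip; fun_prop

lemma measurable_truncClip (p n : ℕ) (K : ℝ) {A : ℝ → ℝ} (hA : Measurable A) :
    Measurable fun w => truncClip p n K (A w) w := by
  have := measurable_clip K hA
  unfold truncClip truncBound
  exact Measurable.ite (measurableSet_lt measurable_const hA) (by fun_prop) this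

lemma abs_factor_le {p n : ℕ} {K q : ℝ} (hK : 0 ≤ K) (h0 : 0 ≤ q) (h1 : q ≤ K + 1) :
    |factor p n q| ≤ (p : ℝ) / n * (1 + K) := by
  rw [factor, abs_mul, abs_of_nonneg (by positivity)]
  gcongr
  rw [abs_le]
  constructor <;> linarith

lemma truncClip_mem_Icc {p n : ℕ} {K : ℝ} (hK : 0 ≤ K) (x : ℝ) {w : ℝ} (hw : 0 < w) :
    truncClip p n K x w ∈ Icc 0 (K + 1) := by
  obtain ⟨h0, h1⟩ := clip_mem_Icc hK x
  have h2 : truncBound p n w ≤ 1 := by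
    unfold truncBound
    have : 0 ≤ (n : ℝ) * (1 + w) / ((n : ℝ) + p + 2) := by positivity
    linarith
  unfold truncClip
  split_ifs
  · exact ⟨le_max_of_le_left h0, max_le (by linarith) (by linarith)⟩
  · exact ⟨h0, by linarith⟩

lemma clip_le_truncClip (p n : ℕ) (K x w : ℝ) : clip K x ≤ truncClip p n K x w := by
  unfold truncClip
  split_ifs
  · exact le_max_left _ _
  · exact le_rfl

lemma truncClip_eq_truncBound {p n : ℕ} {K x w : ℝ} (h : truncClip p n K x w ≠ clip K x) :
    truncClip p n K x w = truncBound p n w := by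
  unfold truncClip at *
  split_ifs at * with hx
  · rcases max_choice (clip K x) (truncBound p n w) with h' | h'
    · exact absurd h' h
    · exact h'
  · exact absurd rfl h

lemma factor_injective {p n : ℕ} (hp : 1 ≤ p) (hn : 1 ≤ n) :
    Function.Injective (factor p n) := by
  intro x y hxy
  have h : (p : ℝ) / n ≠ 0 := by positivity
  have := mul_left_cancel₀ h hxy
  linarith

lemma factor_truncBound {p n : ℕ} (hn : 1 ≤ n) (w : ℝ) :
    factor p n (truncBound p n w) = p * (1 + w) / (n + p + 2 : ℕ) := by
  have hn' : (n : ℝ) ≠ 0 := by positivity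
  have : (n : ℝ) + p + 2 ≠ 0 := by positivity
  unfold factor truncBound
  push_cast
  field_simp
  ring

theorem truncImproves_min {p n : ℕ} (hp : 1 ≤ p) (hn : 1 ≤ n) {φ : ℝ → ℝ}
    (hφ : ContinuousOn φ (Ioi 0))
    (hg : ∀ w : ℝ, 0 < w → IntegrableOn (gIntegrand p n φ) (Ioi w))
    (hδ : ∀ (θ : Vec p) (σ : ℝ), 0 < σ →
      mse p n (shrink φ) θ σ ≤ mse p n (fun z => z.1) θ σ)
    {K : ℝ} (hK : 0 ≤ K) :
    TruncImproves p n φ (fun w => min 1 (K / a p n φ w)) := by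
  set ψ : ℝ → ℝ := fun w => min 1 (K / a p n φ w) with hψ
  have hacont := continuousOn_a hφ hg
  -- Only values on `(0, ∞)` matter, as `W > 0` almost surely; extending by `0` gives a measurable
  -- function on all of `ℝ`.
  set A : ℝ → ℝ := (Ioi 0).indicator (a p n φ) with hA
  have hAm : Measurable A := by
    have h := hacont.measurable_piecewise (g := fun _ => (0 : ℝ)) continuousOn_const measurableSet_Ioi
    rw [hA, ← piecewise_eq_indicator]
    exact h
  have hAa : ∀ w, 0 < w → A w = a p n φ w := fun w hw => indicator_of_mem (mem_Ioi.2 hw) _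
  set c : ℝ → ℝ := fun w => factor p n (clip K (A w)) with hc
  set c' : ℝ → ℝ := fun w => factor p n (truncClip p n K (A w) w) with hc'
  have hcm : Measurable c := ((measurable_const.sub (measurable_clip K hAm)).const_mul _)
  have hcm' : Measurable c' := ((measurable_const.sub (measurable_truncClip p n K hAm)).const_mul _)
  have hM : ∀ w, 0 < w → |c w| ≤ (p : ℝ) / n * (1 + K) ∧ |c' w| ≤ (p : ℝ) / n * (1 + K) := by
    intro w hw
    obtain ⟨h0, h1⟩ := clip_mem_Icc hK (A w)
    obtain ⟨h2, h3⟩ := truncClip_mem_Icc (p := p) (n := n) hK (A w) hw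
    exact ⟨abs_factor_le hK h0 (by linarith), abs_factor_le hK h2 h3⟩
  have hle : ∀ w, 0 < w → c' w ≤ c w := fun w _ => by
    simp only [hc, hc', factor]
    gcongr
    exact clip_le_truncClip p n K _ w
  have heq : ∀ w, 0 < w → c' w ≠ c w → c' w = p * (1 + w) / (n + p + 2 : ℕ) := fun w _ hne => by
    rw [← factor_truncBound hn]
    exact congrArg (factor p n)
      (truncClip_eq_truncBound fun h => hne (congrArg (factor p n) h))
  have hriskψ : ∀ (θ : Vec p) (σ : ℝ), 0 < σ → risk p n φ ψ θ σ = ENNReal.ofReal (σ ^ 4) *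
      ∫⁻ z, ENNReal.ofReal ((z.2 * c (W z) - R p n φ θ σ / σ ^ 2) ^ 2)
        ∂unitLaw p n (σ⁻¹ • θ) := by
    intro θ σ hσ
    rw [risk_eq hn φ ψ θ hσ]
    congr 1
    refine lintegral_congr_ae ?_
    filter_upwards [ae_unitLaw_pos hp hn (σ⁻¹ • θ)] with z hz
    simp only [hc, hAa _ hz.2]
    rfl
  have hriskT : ∀ (θ : Vec p) (σ : ℝ), 0 < σ → risk p n φ (trunc p n φ ψ) θ σ =
      ENNReal.ofReal (σ ^ 4) * ∫⁻ z, ENNReal.ofReal ((z.2 * c' (W z) - R p n φ θ σ / σ ^ 2) ^ 2)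
        ∂unitLaw p n (σ⁻¹ • θ) := by
    intro θ σ hσ
    rw [risk_eq hn φ _ θ hσ]
    congr 1
    refine lintegral_congr_ae ?_
    filter_upwards [ae_unitLaw_pos hp hn (σ⁻¹ • θ)] with z hz
    simp only [hc', hAa _ hz.2]
    rw [hψ, mul_trunc]
  have hR : ∀ (θ : Vec p) (σ : ℝ), 0 < σ → R p n φ θ σ / σ ^ 2 ≤ p := fun θ σ hσ =>
    (div_le_iff₀ (by positivity)).2 (R_le hn hδ θ hσ)
  have hstrict : (∃ w, 0 < w ∧ trunc p n φ ψ w ≠ ψ w) →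
      EverywhereBetter p n φ (trunc p n φ ψ) ψ := by
    rintro ⟨w, hw, hne⟩ θ σ hσ
    have ha : 0 < a p n φ w := by
      by_contra h
      exact hne (by simp [trunc, h])
    have hlt : ψ w < lower p n φ w := by
      by_contra h
      exact hne (by simp [trunc, ha, max_eq_left (not_lt.1 h)])
    have hca : ContinuousAt (a p n φ) w := hacont.continuousAt (Ioi_mem_nhds hw)
    have hcψ : ContinuousAt ψ w :=
      continuousAt_const.min (continuousAt_const.div hca ha.ne')
    have hcl : ContinuousAt (lower p n φ) w :=
      (continuousAt_const.div hca ha.ne').mul (by fun_prop)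
    -- The strict inequalities `0 < a` and `ψ < lower` at `w` persist nearby by continuity.
    have hev : ∀ᶠ v in 𝓝 w, c v - c' v ≠ 0 := by
      filter_upwards [Ioi_mem_nhds hw, hca.eventually_const_lt ha, hcψ.eventually_lt hcl hlt]
        with v hv hav hlv h
      have h1 := factor_injective hp hn (sub_eq_zero.1 h)
      rw [hAa v hv, ← mul_trunc] at h1
      have h2 : ψ v = trunc p n φ ψ v := mul_left_cancel₀ hav.ne' h1
      rw [trunc, if_pos hav, max_eq_right hlv.le] at h2
      exact hlv.ne h2
    rw [hriskψ θ σ hσ, hriskT θ σ hσ]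
    refine (ENNReal.mul_lt_mul_iff_right (by simpa using pow_pos hσ 4) (by finiteness)).2 ?_
    refine lt_of_lt_of_le ?_ (risk_add_gap_le hp hn (σ⁻¹ • θ) hcm hcm' hM hle heq (hR θ σ hσ))
    exact ENNReal.lt_add_right
      (lintegral_risk_lt_top hp hn _ (fun w hw => (hM w hw).2) _).ne
      (gap_pos hp hn _ (hcm.sub hcm') hw hev).ne'
  refine ⟨fun θ σ hσ => ?_, hstrict, ?_⟩
  · rw [hriskψ θ σ hσ, hriskT θ σ hσ]
    refine mul_le_mul_right ?_ _
    exact le_self_add.trans (risk_add_gap_le hp hn (σ⁻¹ • θ) hcm hcm' hM hle heq (hR θ σ hσ))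
  · rintro ⟨w, ⟨-, ha, hw⟩, hlt⟩
    refine hstrict ⟨w, hw, ?_⟩
    have h1 : ψ w < lower p n φ w := (min_le_left _ _).trans_lt hlt
    rw [trunc, if_pos ha, max_eq_right h1.le]
    exact h1.ne'

/-- Domination at `θ = 0`, `σ = 1`; it makes the constant `K` nonnegative for both `psi1` and
`psi2`. -/
lemma alpha_nonneg {p n : ℕ} (hn : 1 ≤ n) {φ : ℝ → ℝ}
    (hδ : ∀ (θ : Vec p) (σ : ℝ), 0 < σ →
      mse p n (shrink φ) θ σ ≤ mse p n (fun z => z.1) θ σ) : 0 ≤ alpha p n φ := by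
  have := R_le hn hδ 0 one_pos
  rw [alpha, Rstar]
  simpa using this

end

end ShrinkageMSE

theorem mainTheorem8 (p n : ℕ) (hp : 3 ≤ p) (hn : 1 ≤ n) (φ : ℝ → ℝ)
    (hφ : ContinuousOn φ (Set.Ioi 0))
    (hφ' : ∃ D : Set ℝ, D.Countable ∧ ∀ t : ℝ, 0 < t → t ∉ D → DifferentiableAt ℝ φ t)
    (hg : ∀ w : ℝ, 0 < w →
      MeasureTheory.IntegrableOn (ShrinkageMSE.gIntegrand p n φ) (Set.Ioi w))
    (hδ : ∀ (θ : ShrinkageMSE.Vec p) (σ : ℝ), 0 < σ →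
      ShrinkageMSE.mse p n (ShrinkageMSE.shrink φ) θ σ ≤
        ShrinkageMSE.mse p n (fun z => z.1) θ σ)
    (hB : (ShrinkageMSE.setB p n φ).Nonempty) :
    (∀ w₀ : ℝ, ShrinkageMSE.IsW p n φ w₀ →
      ShrinkageMSE.TruncImproves p n φ (ShrinkageMSE.psi1 p n φ w₀)) ∧
    ShrinkageMSE.TruncImproves p n φ (ShrinkageMSE.psi2 p n φ) := by
  have hα := ShrinkageMSE.alpha_nonneg hn hδ
  refine ⟨fun w₀ hw₀ => ?_, ?_⟩
  · have hw := hw₀.1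
    have h := ShrinkageMSE.truncImproves_min (by omega) hn hφ hg hδ
      (K := (n : ℝ) / p * ((1 + w₀) / ((n : ℝ) + p + 2)) * ShrinkageMSE.alpha p n φ)
      (by positivity)
    have he : ShrinkageMSE.psi1 p n φ w₀ = fun w => min 1
        ((n : ℝ) / p * ((1 + w₀) / ((n : ℝ) + p + 2)) * ShrinkageMSE.alpha p n φ /
          ShrinkageMSE.a p n φ w) := by
      ext1 w
      rw [ShrinkageMSE.psi1, mul_div_assoc]
    rwa [he]
  · have h := ShrinkageMSE.truncImproves_min (by omega) hn hφ hg hδ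
      (K := ShrinkageMSE.alpha p n φ / p) (by positivity)
    have he : ShrinkageMSE.psi2 p n φ = fun w => min 1
        (ShrinkageMSE.alpha p n φ / p / ShrinkageMSE.a p n φ w) := by
      ext1 w
      rw [ShrinkageMSE.psi2, div_div]
    rwa [he]
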